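/- All graphs are finite and simple. For an orientation $D$ of a graph $G$, an Eulerian subdigraph of $D$ is a spanning subdigraph $H$ (i.e. a set of arcs of $D$, possibly empty and not necessarily connected) in which the indegree of every vertex equals its outdegree; it is even or odd according to the parity of its number of arcs. The Alon–Tarsi number $AT(G)$ is the smallest $k$ such that $G$ has an orientation with maximum outdegree $k-1$ for which the number of even Eulerian subdigraphs differs from the number of odd Eulerian subdigraphs. The total graph $T(G)$ has vertex set $V(G)\cup E(G)$ (a disjoint union); two vertices of $G$ are joined if they are adjacent in $G$, a vertex and an edge of $G$ are joined if they are incident, and two distinct edges of $G$ are joined if they share an endpoint. The $T$-sum $G+_T H$ is the graph with vertex set $(V(G)\cup E(G))\times V(H)$ in which $(u_1,u_2)$ and $(v_1,v_2)$ are adjacent if and only if either $u_1=v_1\in V(G)$ and $u_2v_2\in E(H)$, or $u_2=v_2$ and $u_1v_1\in E(T(G))$. Let $P_n$ denote the path with $n$ vertices. **Corollary 3.11.** For all integers $n,m\ge 2$, \[ AT(P_n +_T P_m)= \begin{cases} 4, & \text{if } (n=4 \text{ and } m\ge 5), \text{ or } (n\ge 7 \text{ and } m=2), \text{ or } (n\ge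 5 \text{ and } m\ge 3);\\ 3, & \text{otherwise.} \end{cases} \] -/

import Mathlib

namespace AlonTarsi

/-- The total graph of `G`: its vertices are the vertices and the edges of `G`; two vertices of `G`
are joined when they are adjacent in `G`, a vertex and an edge when they are incident, and two
edges when they are distinct and share an endpoint. -/
def totalGraph {V : Type*} (G : SimpleGraph V) : SimpleGraph (V ⊕ G.edgeSet) where
  Adj
    | Sum.inl u, Sum.inl v => G.Adj u v
    | Sum.inl u, Sum.inr e => u ∈ (e : Sym2 V)
    | Sum.inr e, Sum.inl u => u ∈ (e : Sym2 V)
    | Sum.inr e, Sum.inr f => G.lineGraph.Adj e f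
  symm := by
    constructor
    rintro (u | e) (v | f) h
    · exact G.adj_symm h
    · exact h
    · exact h
    · exact G.lineGraph.adj_symm h
  loopless := by
    constructor
    rintro (u | e) h
    · exact G.irrefl h
    · exact G.lineGraph.irrefl h

/-- The `T`-sum of `G` and `H`: the Cartesian product of the total graph of `G` with `H`, from which
the copies of the edges of `H` at the edge-vertices of the total graph are removed. -/
def tSum {V W : Type*} (G : SimpleGraph V) (H : SimpleGraph W) :
    SimpleGraph ((V ⊕ G.edgeSet) × W) where
  Adj p q :=
    (∃ u : V, p.1 = Sum.inl u ∧ q.1 = Sum.inl u ∧ H.Adj p.2 q.2) ∨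
      (p.2 = q.2 ∧ (totalGraph G).Adj p.1 q.1)
  symm := by
    constructor
    rintro p q (⟨u, hp, hq, h⟩ | ⟨h, h'⟩)
    · exact Or.inl ⟨u, hq, hp, H.adj_symm h⟩
    · exact Or.inr ⟨h.symm, (totalGraph G).adj_symm h'⟩
  loopless := by
    constructor
    rintro p (⟨u, hp, hq, h⟩ | ⟨h, h'⟩)
    · exact H.irrefl h
    · exact (totalGraph G).irrefl h'

section Digraphs

variable {V : Type*}

/-- `D` is an orientation of the simple graph `G`: every edge of `G` receives exactly one of its two
directions, and there are no other arcs (in particular no loops). -/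
structure IsOrientation (G : SimpleGraph V) (D : Digraph V) : Prop where
  adj_iff : ∀ u v, G.Adj u v ↔ D.Adj u v ∨ D.Adj v u
  asymm : ∀ u v, D.Adj u v → ¬ D.Adj v u

/-- The outdegree of `v` in `D`. -/
noncomputable def outDegree (D : Digraph V) (v : V) : ℕ := {w | D.Adj v w}.ncard

/-- The indegree of `v` in `D`. -/
noncomputable def inDegree (D : Digraph V) (v : V) : ℕ := {u | D.Adj u v}.ncard

/-- The maximum outdegree of a digraph on a finite vertex set. -/
noncomputable def maxOutDegree (D : Digraph V) : ℕ := ⨆ v, outDegree D v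

/-- The number of arcs of `D`. -/
noncomputable def arcCount (D : Digraph V) : ℕ := {a : V × V | D.Adj a.1 a.2}.ncard

/-- `H` is an Eulerian subdigraph of `D`: at every vertex its indegree equals its outdegree.
Neither connectedness nor nonemptiness is required. As usual, subdigraphs are taken to be spanning,
that is, they are determined by their sets of arcs. -/
def IsEulerianSub (D H : Digraph V) : Prop :=
  H ≤ D ∧ ∀ v, inDegree H v = outDegree H v

/-- The even Eulerian subdigraphs of `D`. -/
def evenEulerian (D : Digraph V) : Set (Digraph V) :=
  {H | IsEulerianSub D H ∧ Even (arcCount H)}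

/-- The odd Eulerian subdigraphs of `D`. -/
def oddEulerian (D : Digraph V) : Set (Digraph V) :=
  {H | IsEulerianSub D H ∧ Odd (arcCount H)}

/-- The number of even minus the number of odd Eulerian subdigraphs of `D`. -/
noncomputable def diff (D : Digraph V) : ℤ :=
  ((evenEulerian D).ncard : ℤ) - ((oddEulerian D).ncard : ℤ)

/-- The Alon-Tarsi number of a finite graph `G`: the smallest `k` such that `G` has an orientation
with maximum outdegree `k - 1` and with nonzero `diff`. -/
noncomputable def alonTarsiNumber (G : SimpleGraph V) : ℕ :=
  sInf {k | ∃ D : Digraph V, IsOrientation G D ∧ diff D ≠ 0 ∧ maxOutDegree D + 1 = k}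

end Digraphs

end AlonTarsi

/-!
Write `P_n +_T P_m` as a grid with `m` rows of `2 n - 1` vertices, each row being the square of a
path. Every vertex has at most three neighbours with smaller coordinate sum, so the orientation
towards smaller sums is acyclic with outdegrees at most `3`; its only Eulerian subdigraph is the
empty one, whence `AT ≤ 4`. In the other direction, the outdegrees add up to the number of edges, so
`AT ≥ k + 2` as soon as there are more than `k |V|` edges. With `k = 2` this gives `AT = 4` in the
first case of the formula, and with `k = 1` it gives `AT ≥ 3` always.

In the remaining cases an orientation with outdegrees at most `2` is needed. By Alon and Tarsi, the
signed count of Eulerian subdigraphs of an orientation is, up to sign, the coefficient of the graph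
polynomial at the monomial of outdegrees, which makes sense modulo `7` as well. As the exponents are
at most `2`, interpolation at the cube roots of unity expresses this coefficient as a sum over
colourings of the vertices by `ZMod 3`, and only proper colourings contribute. A proper colouring of
a row is an arithmetic progression, so the sum is a product of `9 × 9` transfer matrices. For
`n = 2` and `n = 3` the number of rows is arbitrary, but there the weights of the last row form an
eigenvector of the square of the transfer matrix; beyond that, finitely many cases remain.
-/

namespace AlonTarsi

open Finset MvPolynomial SimpleGraph

variable {V I : Type*} {G : SimpleGraph V}

/-- The property `AT(G) ≤ k + 1`, in terms of a witnessing orientation. -/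
def HasAlonTarsiOrientation (G : SimpleGraph V) (k : ℕ) : Prop :=
  ∃ D, IsOrientation G D ∧ diff D ≠ 0 ∧ ∀ v, outDegree D v ≤ k

section Acyclic

variable [Finite V]

theorem IsEulerianSub.eq_bot_of_wellFounded {D H : Digraph V}
    (hD : WellFounded fun u v => D.Adj v u) (hH : IsEulerianSub D H) : H = ⊥ := by
  have no_arc_into : ∀ v u, ¬ H.Adj u v := fun v => by
    induction v using hD.induction with
    | _ v ih =>
      have hout : outDegree H v = 0 :=
        (Set.ncard_eq_zero (Set.toFinite _)).2 <|
          Set.eq_empty_of_forall_notMem fun w hw => ih w (hH.1 hw) v hw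
      have hin : {u | H.Adj u v} = ∅ :=
        (Set.ncard_eq_zero (Set.toFinite _)).1 ((hH.2 v).trans hout)
      exact Set.eq_empty_iff_forall_notMem.1 hin
  ext u v
  exact iff_of_false (no_arc_into v u) id

theorem diff_eq_one_of_wellFounded {D : Digraph V} (hD : WellFounded fun u v => D.Adj v u) :
    diff D = 1 := by
  have bot_isEulerianSub : IsEulerianSub D ⊥ := ⟨bot_le, fun v => rfl⟩
  have arcCount_bot : arcCount (⊥ : Digraph V) = 0 := Set.ncard_empty _
  have even_eq : evenEulerian D = {⊥} := Set.eq_singleton_iff_unique_mem.2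
    ⟨⟨bot_isEulerianSub, by simp [arcCount_bot]⟩, fun H hH => hH.1.eq_bot_of_wellFounded hD⟩
  have odd_eq : oddEulerian D = ∅ := Set.eq_empty_of_forall_notMem fun H ⟨hH, hodd⟩ => by
    obtain rfl := hH.eq_bot_of_wellFounded hD
    simp [arcCount_bot] at hodd
  simp [diff, even_eq, odd_eq]

theorem hasAlonTarsiOrientation_of_rank {α : Type*} [LinearOrder α] (r : V → α)
    (hr : ∀ u v, G.Adj u v → r u ≠ r v) {k : ℕ}
    (hk : ∀ v, {w | G.Adj v w ∧ r w < r v}.ncard ≤ k) : HasAlonTarsiOrientation G k := by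
  refine ⟨⟨fun u v => G.Adj u v ∧ r v < r u⟩, ⟨fun u v => ?_, fun u v h h' => h.2.asymm h'.2⟩,
    ?_, hk⟩
  · simp only [G.adj_comm v u, ← and_or_left]
    exact ⟨fun h => ⟨h, (hr u v h).lt_or_gt.symm⟩, And.left⟩
  · have hwf : WellFounded fun u v => r u < r v :=
      @Finite.wellFounded_of_trans_of_irrefl _ _ _ ⟨fun _ _ _ => lt_trans⟩ ⟨fun _ => lt_irrefl _⟩
    exact ne_of_eq_of_ne (diff_eq_one_of_wellFounded (Subrelation.wf And.right hwf)) one_ne_zero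

end Acyclic

theorem card_even_sub_card_odd {ι : Type*} (s : Finset ι) (f : ι → ℕ) :
    (#{i ∈ s | Even (f i)} : ℤ) - #{i ∈ s | Odd (f i)} = ∑ i ∈ s, (-1) ^ f i := by
  rw [card_filter, card_filter, Nat.cast_sum, Nat.cast_sum, ← sum_sub_distrib]
  refine sum_congr rfl fun i _ => ?_
  rcases (f i).even_or_odd with h | h
  · simp [h, Nat.not_odd_iff_even.2 h]
  · simp [h, Nat.not_even_iff_odd.2 h]

theorem neg_one_pow_card_symmDiff {ι R : Type*} [DecidableEq ι] [CommRing R] (s t : Finset ι) :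
    (-1 : R) ^ #(symmDiff s t) = (-1) ^ #s * (-1) ^ #t := by
  have hcard : #(symmDiff s t) + 2 * #(s ∩ t) = #s + #t := by
    rw [symmDiff_def, sup_eq_union, card_union_of_disjoint disjoint_sdiff_sdiff,
      ← card_sdiff_add_card_inter s t, ← card_sdiff_add_card_inter t s, inter_comm t s]
    ring
  rw [← pow_add, ← hcard, pow_add, pow_mul, neg_one_sq, one_pow, mul_one]

/-- An enumeration of the edges of `G` by a type `I`, together with a reference orientation: every
edge `i : I` is directed from `tail i` to `head i`. -/
structure EdgeEnum (G : SimpleGraph V) (I : Type*) where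
  tail : I → V
  head : I → V
  adj_iff : ∀ u v, G.Adj u v ↔ ∃ i, (tail i = u ∧ head i = v) ∨ (tail i = v ∧ head i = u)
  inj : ∀ i j, (tail i = tail j ∧ head i = head j) ∨ (tail i = head j ∧ head i = tail j) → i = j

namespace EdgeEnum

variable (E : EdgeEnum G I)

theorem tail_ne_head (i : I) : E.tail i ≠ E.head i :=
  ((E.adj_iff _ _).2 ⟨i, Or.inl ⟨rfl, rfl⟩⟩).ne

section Orient

variable [DecidableEq I]

/-- The initial vertex of the edge `i` once the edges in `b` have been reversed. -/
def src (b : Finset I) (i : I) : V := if i ∈ b then E.head i else E.tail i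

/-- The terminal vertex of the edge `i` once the edges in `b` have been reversed. -/
def dst (b : Finset I) (i : I) : V := if i ∈ b then E.tail i else E.head i

theorem src_dst_cases (b : Finset I) (i : I) :
    (E.src b i = E.tail i ∧ E.dst b i = E.head i) ∨
      (E.src b i = E.head i ∧ E.dst b i = E.tail i) := by
  by_cases hi : i ∈ b <;> simp [src, dst, hi]

theorem eq_of_src_dst {b : Finset I} {i j : I} (h : E.src b i = E.src b j)
    (h' : E.dst b i = E.dst b j) : i = j := by
  apply E.inj
  rcases E.src_dst_cases b i with hi | hi <;> rcases E.src_dst_cases b j with hj | hj <;>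
    simp_all

theorem eq_of_src_dst_swap {b : Finset I} {i j : I} (h : E.src b i = E.dst b j)
    (h' : E.dst b i = E.src b j) : i = j := by
  apply E.inj
  rcases E.src_dst_cases b i with hi | hi <;> rcases E.src_dst_cases b j with hj | hj <;>
    simp_all

theorem src_ne_dst (b : Finset I) (i : I) : E.src b i ≠ E.dst b i := by
  rcases E.src_dst_cases b i with h | h <;> rw [h.1, h.2]
  exacts [E.tail_ne_head i, (E.tail_ne_head i).symm]

/-- The digraph whose arcs are the edges in `s`, directed as in the reference orientation except
that the edges in `b` are reversed. -/
def sub (b s : Finset I) : Digraph V where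
  Adj u v := ∃ i ∈ s, E.src b i = u ∧ E.dst b i = v

theorem sub_injective (b : Finset I) : Function.Injective (E.sub b) := by
  have subset_of_le : ∀ s t, E.sub b s ≤ E.sub b t → s ⊆ t := fun s t h i hi => by
    obtain ⟨j, hj, hsrc, hdst⟩ := h (⟨i, hi, rfl, rfl⟩ : (E.sub b s).Adj (E.src b i) (E.dst b i))
    rwa [← E.eq_of_src_dst hsrc hdst]
  exact fun s t h => (subset_of_le s t h.le).antisymm (subset_of_le t s h.ge)

theorem arcCount_sub (b s : Finset I) : arcCount (E.sub b s) = #s := by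
  have : {a : V × V | (E.sub b s).Adj a.1 a.2} = (fun i => (E.src b i, E.dst b i)) '' s := by
    ext ⟨u, v⟩
    simp [sub]
  rw [arcCount, this, Set.ncard_image_of_injective, Set.ncard_coe_finset]
  intro i j h
  exact E.eq_of_src_dst (congrArg Prod.fst h) (congrArg Prod.snd h)

theorem outDegree_sub [DecidableEq V] (b s : Finset I) (v : V) :
    outDegree (E.sub b s) v = #{i ∈ s | E.src b i = v} := by
  have : {w | (E.sub b s).Adj v w} = E.dst b '' ↑{i ∈ s | E.src b i = v} := by
    ext w
    simp [sub, and_assoc]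
  rw [outDegree, this, Set.InjOn.ncard_image, Set.ncard_coe_finset]
  intro i hi j hj h
  exact E.eq_of_src_dst ((mem_filter.1 hi).2.trans (mem_filter.1 hj).2.symm) h

theorem inDegree_sub [DecidableEq V] (b s : Finset I) (v : V) :
    inDegree (E.sub b s) v = #{i ∈ s | E.dst b i = v} := by
  have : {u | (E.sub b s).Adj u v} = E.src b '' ↑{i ∈ s | E.dst b i = v} := by
    ext u
    simp [sub, and_assoc, and_comm]
  rw [inDegree, this, Set.InjOn.ncard_image, Set.ncard_coe_finset]
  intro i hi j hj h
  exact E.eq_of_src_dst h ((mem_filter.1 hi).2.trans (mem_filter.1 hj).2.symm)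

variable [Fintype I]

/-- The orientation of `G` obtained from the reference orientation by reversing the edges in `b`. -/
def orient (b : Finset I) : Digraph V := E.sub b univ

theorem isOrientation_orient (b : Finset I) : IsOrientation G (E.orient b) where
  adj_iff u v := by
    simp only [E.adj_iff, orient, sub, mem_univ, true_and, ← exists_or]
    refine exists_congr fun i => ?_
    rcases E.src_dst_cases b i with h | h <;> rw [h.1, h.2]
    tauto
  asymm u v := by
    rintro ⟨i, -, hu, hv⟩ ⟨j, -, hv', hu'⟩
    obtain rfl := E.eq_of_src_dst_swap (hu.trans hu'.symm) (hv.trans hv'.symm)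
    exact E.src_ne_dst b i (hu.trans hu'.symm)

theorem exists_eq_orient {D : Digraph V} (hD : IsOrientation G D) : ∃ b, D = E.orient b := by
  classical
  refine ⟨univ.filter fun i => ¬ D.Adj (E.tail i) (E.head i), ?_⟩
  ext u v
  simp only [orient, sub, src, dst, mem_univ, true_and, mem_filter]
  constructor
  · intro h
    obtain ⟨i, ⟨rfl, rfl⟩ | ⟨rfl, rfl⟩⟩ := (E.adj_iff u v).1 ((hD.adj_iff u v).2 (Or.inl h))
    · exact ⟨i, by simp [h]⟩
    · exact ⟨i, by simp [hD.asymm _ _ h]⟩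
  · rintro ⟨i, rfl, rfl⟩
    have hi := (hD.adj_iff _ _).1 ((E.adj_iff _ _).2 ⟨i, Or.inl ⟨rfl, rfl⟩⟩)
    by_cases h : D.Adj (E.tail i) (E.head i)
    · simp [h]
    · simpa [h] using hi.resolve_left h

theorem sub_le_orient (b s : Finset I) : E.sub b s ≤ E.orient b := by
  rintro u v ⟨i, -, h⟩
  exact ⟨i, mem_univ i, h⟩

theorem exists_eq_sub {b : Finset I} {H : Digraph V} (h : H ≤ E.orient b) :
    ∃ s, H = E.sub b s := by
  classical
  refine ⟨univ.filter fun i => H.Adj (E.src b i) (E.dst b i), ?_⟩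
  ext u v
  constructor
  · intro hu
    obtain ⟨i, -, rfl, rfl⟩ := h hu
    exact ⟨i, by simpa using hu, rfl, rfl⟩
  · rintro ⟨i, hi, rfl, rfl⟩
    simpa using hi

/-- The vector of outdegrees of `E.orient b`, as the exponent of a monomial. -/
noncomputable def outVec (b : Finset I) : V →₀ ℕ := ∑ i, Finsupp.single (E.src b i) 1

theorem outDegree_orient (b : Finset I) (v : V) : outDegree (E.orient b) v = E.outVec b v := by
  classical
  simp [orient, outDegree_sub, outVec, Finsupp.single_apply]

theorem degree_outVec (b : Finset I) : (E.outVec b).degree = Fintype.card I := by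
  simp [outVec]

theorem outVec_symmDiff_apply [DecidableEq V] (b s : Finset I) (v : V) :
    E.outVec (symmDiff b s) v + #{i ∈ s | E.src b i = v} =
      E.outVec b v + #{i ∈ s | E.dst b i = v} := by
  have card_filter_mem (p : I → Prop) [DecidablePred p] :
      #{i ∈ s | p i} = ∑ i, if i ∈ s ∧ p i then 1 else 0 := by
    rw [← card_filter, ← filter_filter, filter_mem_eq_inter, univ_inter]
  simp only [outVec, Finsupp.finsetSum_apply, Finsupp.single_apply, card_filter_mem,
    ← sum_add_distrib]
  refine sum_congr rfl fun i _ => ?_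
  by_cases hb : i ∈ b <;> by_cases hs : i ∈ s <;>
    simp [src, dst, mem_symmDiff, hb, hs, add_comm]

theorem isEulerianSub_sub (b s : Finset I) :
    IsEulerianSub (E.orient b) (E.sub b s) ↔ E.outVec (symmDiff b s) = E.outVec b := by
  classical
  simp only [IsEulerianSub, E.sub_le_orient, true_and, inDegree_sub, outDegree_sub, Finsupp.ext_iff]
  refine forall_congr' fun v => ?_
  have := E.outVec_symmDiff_apply b s v
  omega

theorem ncard_setOf_isEulerianSub_orient [DecidableEq V] (b : Finset I) (p : ℕ → Prop)
    [DecidablePred p] :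
    {H | IsEulerianSub (E.orient b) H ∧ p (arcCount H)}.ncard =
      #{s | E.outVec (symmDiff b s) = E.outVec b ∧ p #s} := by
  have : {H | IsEulerianSub (E.orient b) H ∧ p (arcCount H)} =
      E.sub b '' ↑(univ.filter fun s => E.outVec (symmDiff b s) = E.outVec b ∧ p #s) := by
    ext H
    simp only [Set.mem_ofPred_eq, coe_filter, mem_univ, true_and, Set.mem_image]
    constructor
    · rintro ⟨hH, hp⟩
      obtain ⟨s, rfl⟩ := E.exists_eq_sub hH.1
      exact ⟨s, ⟨(E.isEulerianSub_sub b s).1 hH, by rwa [arcCount_sub] at hp⟩, rfl⟩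
    · rintro ⟨s, ⟨hs, hp⟩, rfl⟩
      exact ⟨(E.isEulerianSub_sub b s).2 hs, by rwa [arcCount_sub]⟩
  rw [this, Set.ncard_image_of_injective _ (E.sub_injective b), Set.ncard_coe_finset]

theorem diff_orient [DecidableEq V] (b : Finset I) :
    diff (E.orient b) = ∑ s with E.outVec (symmDiff b s) = E.outVec b, (-1) ^ #s := by
  rw [diff, evenEulerian, oddEulerian, ncard_setOf_isEulerianSub_orient,
    ncard_setOf_isEulerianSub_orient, ← filter_filter, ← filter_filter,
    card_even_sub_card_odd]

/-- The graph polynomial of `G`, the product of `X (tail i) - X (head i)` over all edges `i`. -/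
noncomputable def graphPolynomial (R : Type*) [CommRing R] : MvPolynomial V R :=
  ∏ i, (X (E.tail i) - X (E.head i))

theorem graphPolynomial_eq_sum (R : Type*) [CommRing R] :
    E.graphPolynomial R = ∑ b : Finset I, monomial (E.outVec b) ((-1) ^ #b) := by
  rw [graphPolynomial, prod_sub, powerset_univ]
  refine sum_congr rfl fun b _ => ?_
  have hb : monomial (E.outVec b) (1 : R) = ∏ i, if i ∈ b then X (E.head i) else X (E.tail i) := by
    rw [outVec, monomial_sum_one]
    exact prod_congr rfl fun i _ => apply_ite (fun v => (X v : MvPolynomial V R)) _ _ _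
  rw [← mul_one ((-1) ^ #b : R), ← C_mul_monomial, hb, prod_ite, filter_mem_eq_inter, univ_inter,
    filter_not, filter_mem_eq_inter, univ_inter]
  simp only [map_pow, map_neg, map_one]
  ring

theorem coeff_graphPolynomial [DecidableEq V] (R : Type*) [CommRing R] (d : V →₀ ℕ) :
    coeff d (E.graphPolynomial R) = ∑ b with E.outVec b = d, (-1) ^ #b := by
  simp only [graphPolynomial_eq_sum, coeff_sum, coeff_monomial, sum_filter]

theorem diff_orient_eq_coeff (R : Type*) [CommRing R] (b : Finset I) :
    (diff (E.orient b) : R) = (-1) ^ #b * coeff (E.outVec b) (E.graphPolynomial R) := by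
  classical
  rw [diff_orient, coeff_graphPolynomial, Int.cast_sum, mul_sum, sum_filter, sum_filter]
  refine Fintype.sum_equiv (symmDiff_right_involutive b).toPerm _ _ fun s => ?_
  simp [neg_one_pow_card_symmDiff, ← mul_assoc, ← mul_pow]

end Orient

section Fintype

variable [Fintype I]

/-- The Alon–Tarsi lemma. -/
theorem exists_isOrientation_of_coeff_ne_zero {R : Type*} [CommRing R] {d : V →₀ ℕ}
    (h : coeff d (E.graphPolynomial R) ≠ 0) :
    ∃ D, IsOrientation G D ∧ diff D ≠ 0 ∧ ∀ v, outDegree D v = d v := by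
  classical
  have ⟨b, hb, _⟩ := exists_ne_zero_of_sum_ne_zero (E.coeff_graphPolynomial R d ▸ h)
  obtain rfl := (mem_filter.1 hb).2
  refine ⟨E.orient b, E.isOrientation_orient b, fun h0 => h ?_, E.outDegree_orient b⟩
  have := E.diff_orient_eq_coeff R b
  rwa [h0, Int.cast_zero, eq_comm, IsUnit.mul_right_eq_zero (isUnit_neg_one.pow _)] at this

theorem isHomogeneous_graphPolynomial (R : Type*) [CommRing R] :
    (E.graphPolynomial R).IsHomogeneous (Fintype.card I) := by
  simpa [graphPolynomial] using IsHomogeneous.prod univ _ (fun _ => 1) fun i _ =>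
    (isHomogeneous_X R (E.tail i)).sub (isHomogeneous_X R (E.head i))

variable [Fintype V]

theorem card_le_card_mul_maxOutDegree (E : EdgeEnum G I) {D : Digraph V}
    (hD : IsOrientation G D) : Fintype.card I ≤ Fintype.card V * maxOutDegree D := by
  classical
  obtain ⟨b, rfl⟩ := E.exists_eq_orient hD
  calc Fintype.card I = ∑ v, outDegree (E.orient b) v := by
        simp only [outDegree_orient, ← Finsupp.degree_eq_sum, degree_outVec]
    _ ≤ Fintype.card V * maxOutDegree (E.orient b) := by
        simpa [maxOutDegree] using sum_le_card_nsmul univ _ _ fun v _ =>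
          le_ciSup (f := outDegree (E.orient b)) (Set.finite_range _).bddAbove v

theorem alonTarsiNumber_eq (E : EdgeEnum G I) {k : ℕ}
    (hk : Fintype.card V * k < Fintype.card I) (h : HasAlonTarsiOrientation G (k + 1)) :
    alonTarsiNumber G = k + 2 := by
  have card_mul_lt {D : Digraph V} (hD : IsOrientation G D) :=
    hk.trans_le (E.card_le_card_mul_maxOutDegree hD)
  have lt_maxOutDegree {D : Digraph V} (hD : IsOrientation G D) : k < maxOutDegree D :=
    lt_of_mul_lt_mul_left (card_mul_lt hD) (Nat.zero_le _)
  obtain ⟨D, hD, hdiff, hout⟩ := h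
  have : Nonempty V := Fintype.card_pos_iff.1 <|
    Nat.pos_of_mul_pos_right ((Nat.zero_le _).trans_lt (card_mul_lt hD))
  have hmax : maxOutDegree D = k + 1 := (ciSup_le hout).antisymm (lt_maxOutDegree hD)
  refine le_antisymm (Nat.sInf_le ⟨D, hD, hdiff, by rw [hmax]⟩) ?_
  refine le_csInf ⟨_, D, hD, hdiff, rfl⟩ ?_
  rintro _ ⟨D', hD', -, rfl⟩
  exact Nat.succ_le_succ (lt_maxOutDegree hD')

end Fintype

end EdgeEnum

section Interpolation

variable {N : ℕ}

theorem eq_of_natCast_eq_of_degree_eq [Finite V] {d e : V →₀ ℕ} (hd : ∀ v, d v < N)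
    (hcast : ∀ v, (d v : ZMod N) = e v) (hdeg : d.degree = e.degree) : d = e := by
  have := Fintype.ofFinite V
  have hle : ∀ v ∈ univ, d v ≤ e v := fun v _ => by
    rw [← Nat.mod_eq_of_lt (hd v), (ZMod.natCast_eq_natCast_iff' _ _ _).1 (hcast v)]
    exact Nat.mod_le _ _
  rw [Finsupp.degree_eq_sum, Finsupp.degree_eq_sum, sum_eq_sum_iff_of_le hle] at hdeg
  exact Finsupp.ext fun v => hdeg v (mem_univ v)

variable [NeZero N] {R : Type*} [CommRing R] [IsDomain R] {ψ : AddChar (ZMod N) R}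

theorem sum_addChar_neg_mul_mul_pow (hψ : ψ.IsPrimitive) (a b : ℕ) :
    ∑ x, ψ (-(a * x)) * ψ x ^ b = if (a : ZMod N) = b then (N : R) else 0 := by
  have term_eq (x : ZMod N) : ψ (-(a * x)) * ψ x ^ b = ψ (x * (b - a)) := by
    rw [← AddChar.map_nsmul_eq_pow, ← AddChar.map_add_eq_mul, nsmul_eq_mul]
    ring_nf
  simp only [term_eq, AddChar.sum_mulShift _ hψ, sub_eq_zero, ZMod.card,
    eq_comm (b := (a : ZMod N)), Nat.cast_ite, Nat.cast_zero]

theorem sum_addChar_mul_eval [Fintype V] [DecidableEq V] (hψ : ψ.IsPrimitive)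
    {P : MvPolynomial V R} {d : V →₀ ℕ} (hP : P.IsHomogeneous d.degree) (hd : ∀ v, d v < N) :
    ∑ c : V → ZMod N, (∏ v, ψ (-(d v * c v))) * eval (fun v => ψ (c v)) P =
      N ^ Fintype.card V * coeff d P := by
  have sum_monomial (e : V →₀ ℕ) (he : e ∈ P.support) :
      ∑ c : V → ZMod N, (∏ v, ψ (-(d v * c v))) * (coeff e P * ∏ v, ψ (c v) ^ e v) =
        if e = d then N ^ Fintype.card V * coeff e P else 0 := by
    calc _ = coeff e P * ∑ c : V → ZMod N, ∏ v, ψ (-(d v * c v)) * ψ (c v) ^ e v := by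
          simp only [mul_sum, prod_mul_distrib, mul_left_comm]
      _ = coeff e P * ∏ v, ∑ x, ψ (-(d v * x)) * ψ x ^ e v := by rw [Fintype.prod_sum]
      _ = coeff e P * ∏ v, if (d v : ZMod N) = e v then (N : R) else 0 := by
          simp only [sum_addChar_neg_mul_mul_pow hψ]
      _ = _ := by
        split_ifs with hed
        · simp [hed, mul_comm]
        · obtain ⟨v, hv⟩ : ∃ v, (d v : ZMod N) ≠ e v := by
            contrapose! hed
            have hdeg : e.degree = d.degree := by
              simpa [Finsupp.degree_eq_weight_one, Pi.one_def] using hP (mem_support_iff.1 he)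
            exact (eq_of_natCast_eq_of_degree_eq hd hed hdeg.symm).symm
          rw [prod_eq_zero (mem_univ v) (if_neg hv), mul_zero]
  simp only [eval_eq', mul_sum (ι := V →₀ ℕ)]
  rw [sum_comm, sum_congr rfl sum_monomial, sum_ite_eq']
  split_ifs with h
  · rfl
  · rw [notMem_support_iff.1 h, mul_zero]

end Interpolation

namespace EdgeEnum

theorem eval_graphPolynomial [Fintype I] (E : EdgeEnum G I) {R : Type*} [CommRing R] (x : V → R) :
    eval x (E.graphPolynomial R) = ∏ i, (x (E.tail i) - x (E.head i)) := by
  simp [graphPolynomial]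

theorem hasAlonTarsiOrientation_of_sum_ne_zero [Fintype V] [DecidableEq V] [Fintype I]
    (E : EdgeEnum G I) {k : ℕ} {R : Type*} [CommRing R] [IsDomain R] {ψ : AddChar (ZMod (k + 1)) R}
    (hψ : ψ.IsPrimitive) (d : V → Fin (k + 1)) (hd : ∑ v, (d v : ℕ) = Fintype.card I)
    (h : ∑ c : V → ZMod (k + 1),
      (∏ v, ψ (-((d v : ℕ) * c v))) * ∏ i, (ψ (c (E.tail i)) - ψ (c (E.head i))) ≠ 0) :
    HasAlonTarsiOrientation G k := by
  set e : V →₀ ℕ := Finsupp.equivFunOnFinite.symm fun v => d v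
  have hdeg : e.degree = Fintype.card I := by rw [Finsupp.degree_eq_sum, ← hd]; rfl
  have hsum := sum_addChar_mul_eval hψ (hdeg ▸ E.isHomogeneous_graphPolynomial R) (d := e)
    fun v => (d v).2
  simp only [eval_graphPolynomial] at hsum
  have ⟨D, hD, hdiff, hout⟩ := E.exists_isOrientation_of_coeff_ne_zero (R := R) (d := e)
    fun h0 => h <| hsum.trans (by rw [h0, mul_zero])
  exact ⟨D, hD, hdiff, fun v => (hout v).trans_le (Fin.is_le (d v))⟩

end EdgeEnum

section Grid

variable (n m : ℕ)

/-- The vertices of the total graph of a path, in the order `v₀, e₀, v₁, e₁, …, vₙ`. -/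
def pathVertex (p : Fin (2 * n + 1)) : Fin (n + 1) ⊕ (pathGraph (n + 1)).edgeSet :=
  if h : p.val % 2 = 0 then Sum.inl ⟨p / 2, by omega⟩
  else Sum.inr ⟨s(⟨p / 2, by omega⟩, ⟨p / 2 + 1, by omega⟩), by simp [pathGraph_adj]⟩

variable {n m}

theorem pathVertex_eq_inl_iff {p : Fin (2 * n + 1)} {i : Fin (n + 1)} :
    pathVertex n p = Sum.inl i ↔ p.val = 2 * i := by
  rw [pathVertex]
  split_ifs with h
  · rw [Sum.inl.injEq, Fin.ext_iff]
    dsimp only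
    omega
  · simp only [false_iff]
    omega

theorem pathVertex_injective : Function.Injective (pathVertex n) := by
  intro p q h
  unfold pathVertex at h
  split_ifs at h
  · simp only [Sum.inl.injEq, Fin.mk.injEq] at h
    omega
  · simp only [Sum.inr.injEq, Subtype.mk.injEq, Sym2.eq_iff, Fin.mk.injEq] at h
    omega

theorem pathVertex_surjective : Function.Surjective (pathVertex n) := by
  rintro (i | ⟨e, he⟩)
  · exact ⟨⟨2 * i, by omega⟩, by simp [pathVertex]⟩
  · induction e with
    | _ a b =>
      wlog hab : a < b generalizing a b
      · simp only [Sym2.eq_swap (a := a)] at he ⊢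
        exact this b a he (((mem_edgeSet _).1 he).ne.lt_or_gt.resolve_right hab)
      have hb : a.val + 1 = b := by
        rw [mem_edgeSet, pathGraph_adj] at he
        omega
      refine ⟨⟨2 * a + 1, by omega⟩, ?_⟩
      rw [pathVertex, dif_neg (by simp)]
      simp only [Sum.inr.injEq, Subtype.mk.injEq, Sym2.eq_iff, Fin.ext_iff]
      omega

theorem totalGraph_pathGraph_adj (p q : Fin (2 * n + 1)) :
    (totalGraph (pathGraph (n + 1))).Adj (pathVertex n p) (pathVertex n q) ↔
      p < q ∧ q.val ≤ p + 2 ∨ q < p ∧ p.val ≤ q + 2 := by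
  unfold pathVertex
  split_ifs <;> simp only [totalGraph, pathGraph_adj, lineGraph_adj_iff_exists, Sym2.mem_iff,
    Fin.ext_iff, ne_eq, Subtype.mk.injEq, Sym2.eq_iff]
  any_goals omega
  constructor
  · rintro ⟨h, v, h1, h2⟩
    omega
  · rintro (h | h)
    · exact ⟨by omega, ⟨q / 2, by omega⟩, by dsimp only; omega⟩
    · exact ⟨by omega, ⟨p / 2, by omega⟩, by dsimp only; omega⟩

variable (n m)

/-- The vertices of the `T`-sum of two paths with `n` and `m` edges, arranged in a grid with
`m + 1` rows of length `2 * n + 1`. -/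
noncomputable def gridVertex : Fin (2 * n + 1) × Fin (m + 1) ≃
    (Fin (n + 1) ⊕ (pathGraph (n + 1)).edgeSet) × Fin (m + 1) :=
  (Equiv.ofBijective _ ⟨pathVertex_injective, pathVertex_surjective⟩).prodCongr (Equiv.refl _)

/-- The edges of the `T`-sum of two paths: those joining neighbours in a row, those joining vertices
at distance two in a row, and those in the columns. -/
abbrev GridEdge : Type :=
  (Fin (2 * n) × Fin (m + 1)) ⊕ (Fin (2 * n - 1) × Fin (m + 1)) ⊕ (Fin (n + 1) × Fin m)

variable {n m}

theorem tSum_pathGraph_adj (x y : Fin (2 * n + 1) × Fin (m + 1)) :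
    (tSum (pathGraph (n + 1)) (pathGraph (m + 1))).Adj (gridVertex n m x) (gridVertex n m y) ↔
      (x.1 = y.1 ∧ x.1.val % 2 = 0 ∧ (x.2.val + 1 = y.2 ∨ y.2.val + 1 = x.2)) ∨
      (x.2 = y.2 ∧ (x.1 < y.1 ∧ y.1.val ≤ x.1 + 2 ∨ y.1 < x.1 ∧ x.1.val ≤ y.1 + 2)) := by
  have hv : ∀ x, gridVertex n m x = (pathVertex n x.1, x.2) := fun _ => rfl
  rw [← totalGraph_pathGraph_adj, hv, hv]
  simp only [tSum, pathGraph_adj, pathVertex_eq_inl_iff, Fin.ext_iff]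
  refine or_congr_left ⟨?_, fun ⟨_, _, _⟩ => ⟨⟨x.1 / 2, by omega⟩, ?_⟩⟩
  · rintro ⟨u, _, _, _⟩
    omega
  · dsimp only
    omega

/-- The endpoint of a grid edge with the larger coordinates. -/
def gridTail : GridEdge n m → Fin (2 * n + 1) × Fin (m + 1)
  | Sum.inl (p, j) => (p.succ, j)
  | Sum.inr (Sum.inl (p, j)) => (⟨p + 2, by omega⟩, j)
  | Sum.inr (Sum.inr (i, j)) => (⟨2 * i, by omega⟩, j.succ)

/-- The endpoint of a grid edge with the smaller coordinates. -/
def gridHead : GridEdge n m → Fin (2 * n + 1) × Fin (m + 1)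
  | Sum.inl (p, j) => (p.castSucc, j)
  | Sum.inr (Sum.inl (p, j)) => (⟨p, by omega⟩, j)
  | Sum.inr (Sum.inr (i, j)) => (⟨2 * i, by omega⟩, j.castSucc)

/-- The edges of the `T`-sum of two paths. -/
noncomputable def gridEnum (n m : ℕ) :
    EdgeEnum (tSum (pathGraph (n + 1)) (pathGraph (m + 1))) (GridEdge n m) where
  tail i := gridVertex n m (gridTail i)
  head i := gridVertex n m (gridHead i)
  adj_iff u v := by
    obtain ⟨⟨⟨p, hp⟩, ⟨j, hj⟩⟩, rfl⟩ := (gridVertex n m).surjective u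
    obtain ⟨⟨⟨q, hq⟩, ⟨j', hj'⟩⟩, rfl⟩ := (gridVertex n m).surjective v
    rw [tSum_pathGraph_adj]
    simp only [EmbeddingLike.apply_eq_iff_eq, Sum.exists, Prod.exists, gridTail, gridHead,
      Prod.mk.injEq, Fin.ext_iff, Fin.lt_def, Fin.val_succ, Fin.val_castSucc]
    constructor
    · rintro (⟨rfl, h2, h | h⟩ | ⟨rfl, h | h⟩)
      · exact Or.inr (Or.inr ⟨⟨p / 2, by omega⟩, ⟨j, by omega⟩, by dsimp only; omega⟩)
      · exact Or.inr (Or.inr ⟨⟨p / 2, by omega⟩, ⟨j', by omega⟩, by dsimp only; omega⟩)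
      · by_cases h1 : q = p + 1
        · exact Or.inl ⟨⟨p, by omega⟩, ⟨j, by omega⟩, by dsimp only; omega⟩
        · exact Or.inr (Or.inl ⟨⟨p, by omega⟩, ⟨j, by omega⟩, by dsimp only; omega⟩)
      · by_cases h1 : p = q + 1
        · exact Or.inl ⟨⟨q, by omega⟩, ⟨j, by omega⟩, by dsimp only; omega⟩
        · exact Or.inr (Or.inl ⟨⟨q, by omega⟩, ⟨j, by omega⟩, by dsimp only; omega⟩)
    · rintro (⟨a, b, h⟩ | ⟨a, b, h⟩ | ⟨a, b, h⟩) <;> omega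
  inj := by
    rintro (⟨a, b⟩ | ⟨a, b⟩ | ⟨a, b⟩) (⟨c, d⟩ | ⟨c, d⟩ | ⟨c, d⟩) h <;>
      simp only [EmbeddingLike.apply_eq_iff_eq, gridTail, gridHead, Prod.mk.injEq, Fin.ext_iff,
        Fin.val_succ, Fin.val_castSucc, Sum.inl.injEq, Sum.inr.injEq, reduceCtorEq] at h ⊢ <;>
      omega

theorem card_gridEdge (n m : ℕ) : Fintype.card (GridEdge n m) =
    2 * n * (m + 1) + ((2 * n - 1) * (m + 1) + (n + 1) * m) := by
  simp [GridEdge]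

noncomputable instance (n m : ℕ) :
    Fintype ((Fin (n + 1) ⊕ (pathGraph (n + 1)).edgeSet) × Fin (m + 1)) :=
  Fintype.ofEquiv _ (gridVertex n m)

theorem card_gridVertex (n m : ℕ) :
    Fintype.card ((Fin (n + 1) ⊕ (pathGraph (n + 1)).edgeSet) × Fin (m + 1)) =
      (2 * n + 1) * (m + 1) := by
  simp [← Fintype.card_congr (gridVertex n m)]

theorem hasAlonTarsiOrientation_three (n m : ℕ) :
    HasAlonTarsiOrientation (tSum (pathGraph (n + 1)) (pathGraph (m + 1))) 3 := by
  let coord (v : (Fin (n + 1) ⊕ (pathGraph (n + 1)).edgeSet) × Fin (m + 1)) : ℕ × ℕ :=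
    (((gridVertex n m).symm v).1, ((gridVertex n m).symm v).2)
  have coord_gridVertex x : coord (gridVertex n m x) = (x.1.val, x.2.val) := by simp [coord]
  have coord_injective : Function.Injective coord :=
    (Fin.val_injective.prodMap Fin.val_injective).comp (gridVertex n m).symm.injective
  refine hasAlonTarsiOrientation_of_rank (fun v => (coord v).1 + (coord v).2) ?_ ?_
  · intro u v
    obtain ⟨x, rfl⟩ := (gridVertex n m).surjective u
    obtain ⟨y, rfl⟩ := (gridVertex n m).surjective v
    simp only [tSum_pathGraph_adj, coord_gridVertex, Fin.ext_iff, Fin.lt_def]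
    omega
  · intro v
    let lower : Finset (ℕ × ℕ) := {((coord v).1 - 1, (coord v).2), ((coord v).1 - 2, (coord v).2),
      ((coord v).1, (coord v).2 - 1)}
    refine le_trans (Set.ncard_le_ncard_of_injOn (t := lower) coord ?_ coord_injective.injOn) ?_
    · rintro w ⟨hadj, hlt⟩
      obtain ⟨x, rfl⟩ := (gridVertex n m).surjective v
      obtain ⟨y, rfl⟩ := (gridVertex n m).surjective w
      simp only [tSum_pathGraph_adj, coord_gridVertex, Fin.ext_iff, Fin.lt_def] at hadj hlt
      simp only [lower, coord_gridVertex, coe_insert, coe_singleton, Set.mem_insert_iff,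
        Set.mem_singleton_iff, Prod.ext_iff]
      omega
    · rw [Set.ncard_coe_finset]
      exact card_le_three

end Grid

section ChainSum

open Matrix

variable {σ R : Type*} [Fintype σ] [CommRing R]

/-- The partition function of a chain of `m + 1` sites with states in `σ`, where the site `j` has
the weight function `f j`, adjacent sites interact through `K`, and the first site carries the
additional weight `u`. -/
def chainSum {m : ℕ} (K : Matrix σ σ R) (u : σ → R) (f : Fin (m + 1) → σ → R) : R :=
  ∑ s : Fin (m + 1) → σ, u (s 0) * ((∏ j, f j (s j)) * ∏ j : Fin m, K (s j.castSucc) (s j.succ))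

/-- The interaction `K` preceded by the weights `f` of one site, that is, `diagonal f * K`. -/
def transferMatrix (K : Matrix σ σ R) (f : σ → R) : Matrix σ σ R := .of fun s t => f s * K s t

theorem chainSum_cons {m : ℕ} (K : Matrix σ σ R) (u f₀ : σ → R) (f : Fin (m + 1) → σ → R) :
    chainSum K u (Fin.cons f₀ f : Fin (m + 2) → σ → R) =
      chainSum K (u ᵥ* transferMatrix K f₀) f := by
  rw [chainSum, chainSum, ← (Fin.consEquiv fun _ => σ).sum_comp, Fintype.sum_prod_type_right]
  refine sum_congr rfl fun t _ => ?_
  rw [vecMul, dotProduct, sum_mul]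
  refine sum_congr rfl fun s _ => ?_
  rw [Fin.prod_univ_succ, Fin.prod_univ_succ (fun j : Fin (m + 1) => K _ _)]
  simp only [Fin.consEquiv_apply, Fin.cons_zero, Fin.cons_succ, Fin.castSucc_zero,
    ← Fin.succ_castSucc, transferMatrix, of_apply]
  ring

theorem chainSum_snoc_const [DecidableEq σ] (K : Matrix σ σ R) (f₁ f₂ : σ → R) (l : ℕ)
    (u : σ → R) : chainSum K u (Fin.snoc (fun _ : Fin l => f₁) f₂ : Fin (l + 1) → σ → R) =
      u ⬝ᵥ (transferMatrix K f₁ ^ l *ᵥ f₂) := by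
  induction l generalizing u with
  | zero =>
    rw [chainSum, ← (Equiv.funUnique (Fin 1) σ).symm.sum_comp]
    simp [Fin.snoc, dotProduct]
  | succ l ih =>
    have cons_const : (fun _ : Fin (l + 1) => f₁) = Fin.cons f₁ fun _ => f₁ :=
      (Fin.cons_self_tail _).symm
    rw [cons_const, ← Fin.cons_snoc_eq_snoc_cons, chainSum_cons, ih, pow_succ', ← mulVec_mulVec,
      dotProduct_mulVec u]

/-- The sequence `a, b, …, b, c` with `l` middle terms. -/
def bordered {α : Type*} (l : ℕ) (a b c : α) : Fin (l + 2) → α :=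
  Fin.cons a (Fin.snoc (fun _ : Fin l => b) c : Fin (l + 1) → α)

theorem comp_bordered {α β : Type*} (g : α → β) (l : ℕ) (a b c : α) :
    g ∘ bordered l a b c = bordered l (g a) (g b) (g c) := by
  simp only [bordered, Fin.comp_cons, Fin.comp_snoc]
  rfl

theorem sum_bordered {M : Type*} [AddCommMonoid M] (l : ℕ) (a b c : M) :
    ∑ j, bordered l a b c j = a + (l • b + c) := by
  rw [bordered, Fin.sum_cons, Fin.sum_snoc, sum_const, card_univ, Fintype.card_fin]

theorem chainSum_bordered [DecidableEq σ] (K : Matrix σ σ R) (u f₀ f₁ f₂ : σ → R) (l : ℕ) :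
    chainSum K u (bordered l f₀ f₁ f₂) =
      (u ᵥ* transferMatrix K f₀) ⬝ᵥ (transferMatrix K f₁ ^ l *ᵥ f₂) := by
  rw [bordered, chainSum_cons, chainSum_snoc_const]

theorem dotProduct_pow_mulVec_ne_zero [IsDomain R] [DecidableEq σ] {M : Matrix σ σ R}
    {x y : σ → R} {a : R} (ha : a ≠ 0) (hy : M *ᵥ M *ᵥ y = a • y) (h0 : x ⬝ᵥ y ≠ 0)
    (h1 : x ⬝ᵥ M *ᵥ y ≠ 0) : ∀ l, x ⬝ᵥ M ^ l *ᵥ y ≠ 0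
  | 0 => by simpa using h0
  | 1 => by simpa using h1
  | l + 2 => by
    rw [pow_add, ← mulVec_mulVec, pow_two, ← mulVec_mulVec, hy, mulVec_smul, dotProduct_smul]
    exact smul_ne_zero ha (dotProduct_pow_mulVec_ne_zero ha hy h0 h1 l)

end ChainSum

section Coloring

open Matrix

/-- The colour of the vertex at position `p` of a row whose colours form the arithmetic progression
with first term `s.1` and difference `s.2`. -/
def rowColor (s : ZMod 3 × ZMod 3) (p : ℕ) : ZMod 3 := s.1 + p * s.2

theorem exists_eq_rowColor {N : ℕ} {c : Fin (N + 1) → ZMod 3}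
    (hc : ∀ p q : Fin (N + 1), p < q → q.val ≤ p + 2 → c q ≠ c p) :
    ∃ s, ∀ p, c p = rowColor s p := by
  have third_color : ∀ x y z : ZMod 3, y ≠ x → z ≠ y → z ≠ x → z = y + (y - x) := by decide
  refine ⟨(c 0, c 1 - c 0), fun ⟨p, hp⟩ => ?_⟩
  induction p using Nat.strong_induction_on with
  | _ p ih =>
    match p with
    | 0 => simp [rowColor]
    | 1 => simp [rowColor, Fin.one_eq_mk_of_lt hp]
    | p + 2 =>
      rw [third_color (c ⟨p, by omega⟩) (c ⟨p + 1, by omega⟩) (c ⟨p + 2, hp⟩)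
        (hc _ _ (by simp) (by simp)) (hc _ _ (by simp) (by simp)) (hc _ _ (by simp) (by simp)),
        ih p (by omega), ih (p + 1) (by omega)]
      simp only [rowColor]
      push_cast
      ring

theorem rowColor_injective {N : ℕ} (hN : 0 < N) :
    Function.Injective fun s (p : Fin (N + 1)) => rowColor s p := by
  intro s t h
  have h0 := congrFun h 0
  have h1 := congrFun h ⟨1, by omega⟩
  simp only [rowColor, Fin.val_zero, Nat.cast_zero, zero_mul, add_zero, Nat.cast_one,
    one_mul] at h0 h1
  exact Prod.ext h0 (add_left_cancel (h0 ▸ h1))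

variable {R : Type*} [CommRing R] (ψ : AddChar (ZMod 3) R) (n : ℕ)

/-- The contribution of a row with outdegrees `d` to the colouring sum. -/
def rowFactor (d : Fin (2 * n + 1) → Fin 3) (s : ZMod 3 × ZMod 3) : R :=
  (∏ p, ψ (-((d p : ℕ) * rowColor s p))) *
    ((∏ p : Fin (2 * n), (ψ (rowColor s (p + 1)) - ψ (rowColor s p))) *
      ∏ p : Fin (2 * n - 1), (ψ (rowColor s (p + 2)) - ψ (rowColor s p)))

/-- The contribution of the edges between two consecutive rows to the colouring sum. -/
def colMatrix : Matrix (ZMod 3 × ZMod 3) (ZMod 3 × ZMod 3) R :=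
  .of fun s t => ∏ i : Fin (n + 1), (ψ (rowColor t (2 * i)) - ψ (rowColor s (2 * i)))

variable {n} {m : ℕ}

theorem sum_coloring_eq_chainSum (hn : 0 < n) (d : Fin (m + 1) → Fin (2 * n + 1) → Fin 3) :
    ∑ c : Fin (2 * n + 1) × Fin (m + 1) → ZMod 3, (∏ x, ψ (-((d x.2 x.1 : ℕ) * c x))) *
      ∏ i, (ψ (c (gridTail i)) - ψ (c (gridHead i))) =
    chainSum (colMatrix ψ n) 1 fun j => rowFactor ψ n (d j) := by
  symm
  refine Fintype.sum_of_injective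
    (fun (s : Fin (m + 1) → ZMod 3 × ZMod 3) x => rowColor (s x.2) x.1) ?_ _ _ ?_ ?_
  · intro s t h
    funext j
    exact rowColor_injective (N := 2 * n) (by omega) (funext fun p => congrFun h (p, j))
  · intro c hc
    by_contra h
    have hne (i : GridEdge n m) : c (gridTail i) ≠ c (gridHead i) := fun hi =>
      h (mul_eq_zero_of_right _ (prod_eq_zero (mem_univ i) (by rw [hi, sub_self])))
    choose s hs using fun j => exists_eq_rowColor (c := fun p => c (p, j)) fun p q hpq hqp => by
      obtain hq | hq : q.val = p + 1 ∨ q.val = p + 2 := by omega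
      · rw [show q = ⟨p + 1, by omega⟩ from Fin.ext hq]
        exact hne (Sum.inl (⟨p, by omega⟩, j))
      · rw [show q = ⟨p + 2, by omega⟩ from Fin.ext hq]
        exact hne (Sum.inr (Sum.inl (⟨p, by omega⟩, j)))
    exact hc ⟨s, funext fun x => (hs x.2 x.1).symm⟩
  · intro s
    simp only [rowFactor, colMatrix, prod_mul_distrib, Fintype.prod_sum_type, gridTail, gridHead,
      Fintype.prod_prod_type_right, Pi.one_apply, one_mul, of_apply]
    rw [mul_assoc, mul_assoc]
    rfl

theorem hasAlonTarsiOrientation_two_of_chainSum_ne_zero [IsDomain R] (hψ : ψ.IsPrimitive)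
    (hn : 0 < n) (d : Fin (m + 1) → Fin (2 * n + 1) → Fin 3)
    (hd : ∑ j, ∑ p, (d j p : ℕ) = Fintype.card (GridEdge n m))
    (h : chainSum (colMatrix ψ n) 1 (fun j => rowFactor ψ n (d j)) ≠ 0) :
    HasAlonTarsiOrientation (tSum (pathGraph (n + 1)) (pathGraph (m + 1))) 2 := by
  classical
  let e := gridVertex n m
  refine (gridEnum n m).hasAlonTarsiOrientation_of_sum_ne_zero hψ
    (fun v => d (e.symm v).2 (e.symm v).1) ?_ ?_
  · rw [← hd, ← e.sum_comp, Fintype.sum_prod_type_right]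
    simp only [Equiv.symm_apply_apply]
  · rw [← (e.arrowCongr (Equiv.refl (ZMod 3))).sum_comp]
    rw [← sum_coloring_eq_chainSum ψ hn] at h
    convert h using 4 with c _ i
    · rw [← e.prod_comp]
      simp
    · simp [gridEnum, e]

theorem hasAlonTarsiOrientation_two_of_transferMatrix [IsDomain R] (hψ : ψ.IsPrimitive)
    (hn : 0 < n) {l : ℕ} (d₀ d₁ d₂ : Fin (2 * n + 1) → Fin 3)
    (hd : ∑ p, (d₀ p : ℕ) + (l * ∑ p, (d₁ p : ℕ) + ∑ p, (d₂ p : ℕ)) =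
      Fintype.card (GridEdge n (l + 1)))
    (h : (1 ᵥ* transferMatrix (colMatrix ψ n) (rowFactor ψ n d₀)) ⬝ᵥ
      (transferMatrix (colMatrix ψ n) (rowFactor ψ n d₁) ^ l *ᵥ rowFactor ψ n d₂) ≠ 0) :
    HasAlonTarsiOrientation (tSum (pathGraph (n + 1)) (pathGraph (l + 2))) 2 := by
  refine hasAlonTarsiOrientation_two_of_chainSum_ne_zero ψ hψ hn (bordered l d₀ d₁ d₂) ?_ ?_
  · let total (d : Fin (2 * n + 1) → Fin 3) : ℕ := ∑ p, (d p : ℕ)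
    calc ∑ j, (total ∘ bordered l d₀ d₁ d₂) j = total d₀ + (l • total d₁ + total d₂) := by
          rw [comp_bordered, sum_bordered]
      _ = Fintype.card (GridEdge n (l + 1)) := hd
  · rwa [← chainSum_bordered, ← comp_bordered (rowFactor ψ n)] at h

end Coloring

section Cases

/-- The character `x ↦ 2 ^ x` of `ZMod 3` with values in `ZMod 7`, where `2` is a primitive cube
root of unity. -/
def cubicChar : AddChar (ZMod 3) (ZMod 7) where
  toFun := ![1, 2, 4]
  map_zero_eq_one' := rfl
  map_add_eq_mul' := by decide

instance : Fact (Nat.Prime 7) := ⟨by decide⟩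

theorem isPrimitive_cubicChar : cubicChar.IsPrimitive :=
  AddChar.IsPrimitive.of_ne_one (AddChar.ne_one_iff.2 ⟨1, by decide⟩)

open Matrix

theorem hasAlonTarsiOrientation_two_pathGraph_two (l : ℕ) :
    HasAlonTarsiOrientation (tSum (pathGraph 2) (pathGraph (l + 2))) 2 := by
  refine hasAlonTarsiOrientation_two_of_transferMatrix cubicChar isPrimitive_cubicChar one_pos
    ![1, 2, 0] ![2, 2, 1] ![2, 2, 1] ?_ ?_
  · change 3 + (l * 5 + 5) = _
    rw [card_gridEdge]
    omega
  -- The outdegrees of the last row make its weights an eigenvector of the squared transfer matrix.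
  · exact dotProduct_pow_mulVec_ne_zero (a := 1) (by decide) (by decide +kernel)
      (by decide +kernel) (by decide +kernel) l

theorem hasAlonTarsiOrientation_two_pathGraph_three (l : ℕ) :
    HasAlonTarsiOrientation (tSum (pathGraph 3) (pathGraph (l + 2))) 2 := by
  refine hasAlonTarsiOrientation_two_of_transferMatrix cubicChar isPrimitive_cubicChar two_pos
    ![0, 2, 2, 2, 2] (fun _ => 2) ![2, 1, 2, 2, 2] ?_ ?_
  · change 8 + (l * 10 + 9) = _
    rw [card_gridEdge]
    omega
  · exact dotProduct_pow_mulVec_ne_zero (a := 2) (by decide) (by decide +kernel)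
      (by decide +kernel) (by decide +kernel) l

theorem hasAlonTarsiOrientation_two_pathGraph_four {l : ℕ} (hl : l ≤ 2) :
    HasAlonTarsiOrientation (tSum (pathGraph 4) (pathGraph (l + 2))) 2 := by
  interval_cases l
  · exact hasAlonTarsiOrientation_two_of_transferMatrix cubicChar isPrimitive_cubicChar three_pos
      ![0, 2, 2, 2, 2, 2, 2] (fun _ => 2) (fun _ => 2) (by decide) (by decide +kernel)
  · exact hasAlonTarsiOrientation_two_of_transferMatrix cubicChar isPrimitive_cubicChar three_pos
      ![2, 1, 2, 2, 2, 2, 2] (fun _ => 2) (fun _ => 2) (by decide) (by decide +kernel)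
  · exact hasAlonTarsiOrientation_two_of_transferMatrix cubicChar isPrimitive_cubicChar three_pos
      (fun _ => 2) (fun _ => 2) (fun _ => 2) (by decide) (by decide +kernel)

theorem hasAlonTarsiOrientation_two_pathGraph_five :
    HasAlonTarsiOrientation (tSum (pathGraph 5) (pathGraph 2)) 2 :=
  hasAlonTarsiOrientation_two_of_transferMatrix cubicChar isPrimitive_cubicChar four_pos
    ![1, 2, 2, 2, 2, 2, 2, 2, 2] (fun _ => 2) (fun _ => 2) (by decide) (by decide +kernel)

theorem hasAlonTarsiOrientation_two_pathGraph_six :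
    HasAlonTarsiOrientation (tSum (pathGraph 6) (pathGraph 2)) 2 :=
  hasAlonTarsiOrientation_two_of_transferMatrix cubicChar isPrimitive_cubicChar (by decide)
    (fun _ => 2) (fun _ => 2) (fun _ => 2) (by decide) (by decide +kernel)

theorem hasAlonTarsiOrientation_two {n m : ℕ} (hn : 2 ≤ n) (hm : 2 ≤ m)
    (h : ¬((n = 4 ∧ 5 ≤ m) ∨ (7 ≤ n ∧ m = 2) ∨ (5 ≤ n ∧ 3 ≤ m))) :
    HasAlonTarsiOrientation (tSum (pathGraph n) (pathGraph m)) 2 := by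
  obtain ⟨l, rfl⟩ := Nat.exists_eq_add_of_le' hm
  have hn6 : n ≤ 6 := by omega
  interval_cases n
  · exact hasAlonTarsiOrientation_two_pathGraph_two l
  · exact hasAlonTarsiOrientation_two_pathGraph_three l
  · exact hasAlonTarsiOrientation_two_pathGraph_four (by omega)
  · obtain rfl : l = 0 := by omega
    exact hasAlonTarsiOrientation_two_pathGraph_five
  · obtain rfl : l = 0 := by omega
    exact hasAlonTarsiOrientation_two_pathGraph_six

end Cases

theorem card_gridVertex_mul_two_lt {n m : ℕ}
    (h : (n = 3 ∧ 4 ≤ m) ∨ (6 ≤ n ∧ m = 1) ∨ (4 ≤ n ∧ 2 ≤ m)) :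
    Fintype.card ((Fin (n + 1) ⊕ (pathGraph (n + 1)).edgeSet) × Fin (m + 1)) * 2 <
      Fintype.card (GridEdge n m) := by
  rw [card_gridVertex, card_gridEdge]
  rcases h with ⟨rfl, _⟩ | ⟨_, rfl⟩ | ⟨hn, hm⟩
  · omega
  · omega
  · obtain ⟨a, rfl⟩ := Nat.exists_eq_add_of_le' hn
    obtain ⟨b, rfl⟩ := Nat.exists_eq_add_of_le' hm
    rw [show 2 * (a + 4) - 1 = 2 * a + 7 by omega]
    nlinarith

theorem card_gridVertex_lt {n m : ℕ} (hn : 1 ≤ n) (hm : 1 ≤ m) :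
    Fintype.card ((Fin (n + 1) ⊕ (pathGraph (n + 1)).edgeSet) × Fin (m + 1)) <
      Fintype.card (GridEdge n m) := by
  rw [card_gridVertex, card_gridEdge]
  obtain ⟨a, rfl⟩ := Nat.exists_eq_add_of_le' hn
  obtain ⟨b, rfl⟩ := Nat.exists_eq_add_of_le' hm
  rw [show 2 * (a + 1) - 1 = 2 * a + 1 by omega]
  nlinarith

end AlonTarsi

theorem corollary3p11 (n m : ℕ) (hn : 2 ≤ n) (hm : 2 ≤ m) :
    AlonTarsi.alonTarsiNumber
        (AlonTarsi.tSum (SimpleGraph.pathGraph n) (SimpleGraph.pathGraph m)) =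
      if (n = 4 ∧ 5 ≤ m) ∨ (7 ≤ n ∧ m = 2) ∨ (5 ≤ n ∧ 3 ≤ m) then 4 else 3 := by
  obtain ⟨k, rfl⟩ := Nat.exists_eq_add_of_le' (show 1 ≤ n by omega)
  obtain ⟨l, rfl⟩ := Nat.exists_eq_add_of_le' (show 1 ≤ m by omega)
  split_ifs with h
  · exact (AlonTarsi.gridEnum k l).alonTarsiNumber_eq
      (AlonTarsi.card_gridVertex_mul_two_lt (by omega))
      (AlonTarsi.hasAlonTarsiOrientation_three k l)
  · exact (AlonTarsi.gridEnum k l).alonTarsiNumber_eq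
      ((mul_one _).trans_lt (AlonTarsi.card_gridVertex_lt (by omega) (by omega)))
      (AlonTarsi.hasAlonTarsiOrientation_two hn hm h)
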